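/- Call a $3$-uniform hypergraph a 3-graph. A core in a 3-graph is a subgraph with non-empty vertex set in which every vertex has degree at least $2$. For every $c>0$ there is an $m_0$ such that the following holds for every finite group $\Gamma$ with $m\ge m_0$ elements and every $S\subseteq\Gamma\times\Gamma$ with $|S|\ge cm^2$. Let $H_S$ be the tripartite 3-graph whose three vertex classes are disjoint copies $\Gamma^{(0)},\Gamma^{(1)},\Gamma^{(2)}$ of $\Gamma$ and whose edges are the triples $\{a^{(0)},b^{(1)},(ab)^{(2)}\}$ with $(a,b)\in S$. Then $H_S$ contains a core on at most $12$ vertices. The same is true when the vertices are the elements of the group themselves: the 3-graph on vertex set $\Gamma$ whose edges are the sets $\{a,b,ab\}$ with $(a,b)\in S$ and $a,b,ab$ pairwise distinct also contains a core on at most $12$ vertices. -/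

import Mathlib

/-- A 3-uniform hypergraph on the vertex type `V`. -/
structure ThreeGraph (V : Type*) where
  /-- The set of edges. -/
  edges : Set (Finset V)
  /-- Every edge consists of exactly three vertices. -/
  card_edge : ∀ e ∈ edges, e.card = 3

namespace ThreeGraph

/-- The subgraph of `H` with vertex set `U` and edge set `F` is a core: it is a non-empty
subgraph in which every vertex has degree at least two. -/
structure IsCore {V : Type*} [DecidableEq V] (H : ThreeGraph V)
    (U : Finset V) (F : Finset (Finset V)) : Prop where
  nonempty : U.Nonempty
  edges_mem : ∀ e ∈ F, e ∈ H.edges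
  edges_subset : ∀ e ∈ F, e ⊆ U
  two_le_degree : ∀ v ∈ U, 2 ≤ (F.filter (fun e => v ∈ e)).card

/-- `H` contains a core on at most `k` vertices. -/
def HasCoreAtMost {V : Type*} [DecidableEq V] (H : ThreeGraph V) (k : ℕ) : Prop :=
  ∃ (U : Finset V) (F : Finset (Finset V)), H.IsCore U F ∧ U.card ≤ k

end ThreeGraph

/-- The triple `(a, b, ab)` as an edge of a tripartite hypergraph whose three vertex classes
`{0} × Γ`, `{1} × Γ`, `{2} × Γ` are disjoint copies of `Γ`. -/
def tripartiteTriple {Γ : Type*} [Group Γ] [DecidableEq Γ] (p : Γ × Γ) : Finset (Fin 3 × Γ) :=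
  {(0, p.1), (1, p.2), (2, p.1 * p.2)}

theorem card_tripartiteTriple {Γ : Type*} [Group Γ] [DecidableEq Γ] (p : Γ × Γ) :
    (tripartiteTriple p).card = 3 := by
  simp [tripartiteTriple]

/-- The tripartite 3-graph of the triples `(a, b, ab)`, `(a, b) ∈ S`. -/
def tripartiteTripleSystem {Γ : Type*} [Group Γ] [DecidableEq Γ] (S : Finset (Γ × Γ)) :
    ThreeGraph (Fin 3 × Γ) where
  edges := {e | ∃ p ∈ S, e = tripartiteTriple p}
  card_edge := by
    rintro e ⟨p, -, rfl⟩
    exact card_tripartiteTriple p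

/-- The 3-graph on the elements of `Γ` itself, whose edges are the sets `{a, b, ab}` with
`(a, b) ∈ S` and `a`, `b`, `ab` pairwise distinct. -/
def elementTripleSystem {Γ : Type*} [Group Γ] [DecidableEq Γ] (S : Finset (Γ × Γ)) :
    ThreeGraph Γ where
  edges := {e | e.card = 3 ∧ ∃ p ∈ S, e = {p.1, p.2, p.1 * p.2}}
  card_edge := fun _ he => he.1

/-! By Cauchy–Schwarz a dense `S` contains on the order of `m ^ 4` rectangles `{a, a'} × {b, b'}`.
The products `ab`, `ab'`, `a'b` take at most `m ^ 3` values and determine the fourth, since `a'b' =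
(a'b)(ab)⁻¹(ab')`. Hence two rectangles share all four products. Their eight edges form a cube: the
four common products and the four sides of each rectangle are 12 vertices, each on two edges. Only
`O(m ^ 3)` rectangles are degenerate, and a large fibre leaves room to avoid coincidences between
the two rectangles, so the argument also works inside a single copy of `Γ`. The main steps are
`card_pow_four_le_card_rectangles`, `exists_pair_properRectangles` and `hasCoreAtMost_of_cube`. -/

namespace ThreeGraph

/-- Eight edges `{x i k, y j k, z i j}` indexed by the vertices of a cube, such that any two
edges indexed by adjacent vertices differ, form a core on at most twelve vertices. -/
theorem hasCoreAtMost_of_cube {V : Type*} [DecidableEq V] (H : ThreeGraph V)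
    (x y z : Bool × Bool → V)
    (hmem : ∀ i j k, ({x (i, k), y (j, k), z (i, j)} : Finset V) ∈ H.edges)
    (hx : ∀ i k, ({x (i, k), y (false, k), z (i, false)} : Finset V) ≠
      {x (i, k), y (true, k), z (i, true)})
    (hy : ∀ j k, ({x (false, k), y (j, k), z (false, j)} : Finset V) ≠
      {x (true, k), y (j, k), z (true, j)})
    (hz : ∀ i j, ({x (i, false), y (j, false), z (i, j)} : Finset V) ≠
      {x (i, true), y (j, true), z (i, j)}) :
    H.HasCoreAtMost 12 := by
  let E : Bool × Bool × Bool → Finset V :=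
    fun q => {x (q.1, q.2.2), y (q.2.1, q.2.2), z (q.1, q.2.1)}
  refine ⟨Finset.univ.image x ∪ Finset.univ.image y ∪ Finset.univ.image z,
    Finset.univ.image E, ⟨⟨x (true, true), by simp⟩, ?_, ?_, ?_⟩, ?_⟩
  · simp only [Finset.mem_image, Finset.mem_univ, true_and]
    rintro _ ⟨⟨i, j, k⟩, rfl⟩
    exact hmem i j k
  · simp only [Finset.mem_image, Finset.mem_univ, true_and]
    rintro _ ⟨⟨i, j, k⟩, rfl⟩ v hv
    simp only [E, Finset.mem_insert, Finset.mem_singleton] at hv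
    simp only [Finset.mem_union, Finset.mem_image, Finset.mem_univ, true_and]
    rcases hv with rfl | rfl | rfl
    exacts [.inl (.inl ⟨_, rfl⟩), .inl (.inr ⟨_, rfl⟩), .inr ⟨_, rfl⟩]
  -- `E` need not be injective: two distinct edges through each vertex suffice.
  · have key : ∀ (v : V) (q r : Bool × Bool × Bool), v ∈ E q → v ∈ E r → E q ≠ E r →
        2 ≤ ((Finset.univ.image E).filter (fun e => v ∈ e)).card := fun v q r hq hr hqr =>
      Finset.one_lt_card.2 ⟨E q, by simp [hq], E r, by simp [hr], hqr⟩
    intro v hv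
    simp only [Finset.mem_union, Finset.mem_image, Finset.mem_univ, true_and] at hv
    rcases hv with (⟨⟨i, k⟩, rfl⟩ | ⟨⟨j, k⟩, rfl⟩) | ⟨⟨i, j⟩, rfl⟩
    · exact key _ (i, false, k) (i, true, k) (by simp [E]) (by simp [E]) (hx i k)
    · exact key _ (false, j, k) (true, j, k) (by simp [E]) (by simp [E]) (hy j k)
    · exact key _ (i, j, false) (i, j, true) (by simp [E]) (by simp [E]) (hz i j)
  · have h4 : ∀ w : Bool × Bool → V, (Finset.univ.image w).card ≤ 4 :=
      fun w => Finset.card_image_le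
    have h1 := Finset.card_union_le (Finset.univ.image x ∪ Finset.univ.image y)
      (Finset.univ.image z)
    have h2 := Finset.card_union_le (Finset.univ.image x) (Finset.univ.image y)
    linarith [h4 x, h4 y, h4 z]

end ThreeGraph

/-- The quadruples `(a, a', b, b')` with `{a, a'} × {b, b'} ⊆ S`. -/
def rectangles {α : Type*} [Fintype α] [DecidableEq α] (S : Finset (α × α)) :
    Finset (α × α × α × α) :=
  Finset.univ.filter fun q =>
    (q.1, q.2.2.1) ∈ S ∧ (q.1, q.2.2.2) ∈ S ∧ (q.2.1, q.2.2.1) ∈ S ∧ (q.2.1, q.2.2.2) ∈ S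

/-- Cauchy–Schwarz twice: on the degrees of the `b`, then on the codegrees of the pairs `(a, a')`.
-/
theorem card_pow_four_le_card_rectangles {α : Type*} [Fintype α] [DecidableEq α]
    (S : Finset (α × α)) :
    S.card ^ 4 ≤ Fintype.card α ^ 4 * (rectangles S).card := by
  let f : α → α → ℕ := fun a b => if (a, b) ∈ S then 1 else 0
  have hS : S.card = ∑ b, ∑ a, f a b := by
    rw [Finset.sum_comm, ← Fintype.sum_prod_type' f]
    simp [f]
  have hR : (rectangles S).card = ∑ p : α × α, (∑ b, f p.1 b * f p.2 b) ^ 2 := by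
    rw [rectangles, Finset.card_filter]
    simp only [Fintype.sum_prod_type, sq, Finset.sum_mul_sum]
    refine Finset.sum_congr rfl fun a _ => Finset.sum_congr rfl fun a' _ =>
      Finset.sum_congr rfl fun b _ => Finset.sum_congr rfl fun b' _ => ?_
    simp only [f]
    split_ifs <;> simp_all
  have h1 : (∑ b, ∑ a, f a b) ^ 2 ≤ Fintype.card α * ∑ b, (∑ a, f a b) ^ 2 :=
    sq_sum_le_card_mul_sum_sq
  have h2 : (∑ p : α × α, ∑ b, f p.1 b * f p.2 b) ^ 2 ≤
      Fintype.card (α × α) * ∑ p : α × α, (∑ b, f p.1 b * f p.2 b) ^ 2 :=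
    sq_sum_le_card_mul_sum_sq
  -- Both sides count triples `(a, a', b)` with `(a, b)` and `(a', b)` in `S`.
  have h3 : ∑ b, (∑ a, f a b) ^ 2 = ∑ p : α × α, ∑ b, f p.1 b * f p.2 b := by
    rw [Finset.sum_comm]
    simp only [sq, Finset.sum_mul_sum, Fintype.sum_prod_type]
  rw [← hS, h3] at h1
  rw [← hR, Fintype.card_prod] at h2
  calc S.card ^ 4 = (S.card ^ 2) ^ 2 := by ring
    _ ≤ _ := Nat.pow_le_pow_left h1 2
    _ = Fintype.card α ^ 2 * (∑ p : α × α, ∑ b, f p.1 b * f p.2 b) ^ 2 := by ring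
    _ ≤ _ := Nat.mul_le_mul_left _ h2
    _ = _ := by ring

section Group

variable {Γ : Type*} [Group Γ] [DecidableEq Γ]

/-- The pairs `(a, b)` of `S` for which `a`, `b`, `ab` are pairwise distinct. -/
def properPairs (S : Finset (Γ × Γ)) : Finset (Γ × Γ) :=
  S.filter fun p => p.1 ≠ 1 ∧ p.2 ≠ 1 ∧ p.1 ≠ p.2

theorem card_triple_of_mem_properPairs {S : Finset (Γ × Γ)} {a b : Γ}
    (h : (a, b) ∈ properPairs S) : ({a, b, a * b} : Finset Γ).card = 3 := by
  simp only [properPairs, Finset.mem_filter] at h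
  rw [Finset.card_eq_three]
  exact ⟨a, b, a * b, h.2.2.2, by simpa using h.2.2.1, by simpa using h.2.1, rfl⟩

variable [Fintype Γ]

theorem card_le_card_properPairs (S : Finset (Γ × Γ)) :
    S.card ≤ (properPairs S).card + 3 * Fintype.card Γ := by
  have hsub : S ⊆ properPairs S ∪ (Finset.univ.image (fun b : Γ => ((1 : Γ), b)) ∪
      (Finset.univ.image (fun a : Γ => (a, (1 : Γ))) ∪
        Finset.univ.image (fun a : Γ => (a, a)))) := by
    rintro ⟨a, b⟩ h
    simp only [properPairs, Finset.mem_union, Finset.mem_filter, Finset.mem_image,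
      Finset.mem_univ, true_and, Prod.mk.injEq, h]
    by_cases h1 : a = 1
    · simp [h1]
    by_cases h2 : b = 1
    · simp [h2]
    by_cases h3 : a = b
    · simp [h3]
    · simp [h1, h2, h3]
  have hi : ∀ g : Γ → Γ × Γ, (Finset.univ.image g).card ≤ Fintype.card Γ :=
    fun g => Finset.card_image_le
  have := (Finset.card_le_card hsub).trans <| (Finset.card_union_le _ _).trans <| Nat.add_le_add_left
    ((Finset.card_union_le _ _).trans <| Nat.add_le_add (hi _) <|
      (Finset.card_union_le _ _).trans <| Nat.add_le_add (hi _) (hi _)) (properPairs S).card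
  linarith

/-- A rectangle in the proper pairs whose sides are not degenerate, not even after the three
vertex classes have been identified. -/
def properRectangles (S : Finset (Γ × Γ)) : Finset (Γ × Γ × Γ × Γ) :=
  (rectangles (properPairs S)).filter fun q =>
    q.1 ≠ q.2.1 ∧ q.2.2.1 ≠ q.2.2.2 ∧ q.2.2.2 ≠ q.1 * q.2.2.1 ∧ q.2.2.2 ≠ q.2.1 * q.2.2.1 ∧
      q.2.1 ≠ q.1 * q.2.2.1 ∧ q.2.1 ≠ q.1 * q.2.2.2

/-- Each of the six forbidden equations expresses one coordinate through the other three. -/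
theorem card_rectangles_le (S : Finset (Γ × Γ)) :
    (rectangles (properPairs S)).card ≤
      (properRectangles S).card + 6 * Fintype.card Γ ^ 3 := by
  let I : (Γ × Γ × Γ → Γ × Γ × Γ × Γ) → Finset (Γ × Γ × Γ × Γ) := fun g => Finset.univ.image g
  have hI : ∀ g, (I g).card ≤ Fintype.card Γ ^ 3 := fun g =>
    Finset.card_image_le.trans (by simp [pow_three])
  have hsub : rectangles (properPairs S) ⊆ properRectangles S ∪
      (I (fun r => (r.1, r.1, r.2.1, r.2.2)) ∪ (I (fun r => (r.1, r.2.1, r.2.2, r.2.2)) ∪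
      (I (fun r => (r.1, r.2.1, r.2.2, r.1 * r.2.2)) ∪
      (I (fun r => (r.1, r.2.1, r.2.2, r.2.1 * r.2.2)) ∪
      (I (fun r => (r.1, r.1 * r.2.1, r.2.1, r.2.2)) ∪
      I (fun r => (r.1, r.1 * r.2.2, r.2.1, r.2.2))))))) := by
    rintro ⟨a, a', b, b'⟩ h
    simp only [properRectangles, I, Finset.mem_union, Finset.mem_filter, Finset.mem_image,
      Finset.mem_univ, true_and, Prod.mk.injEq, Prod.exists, h]
    grind
  have := (Finset.card_le_card hsub).trans <| (Finset.card_union_le _ _).trans <| Nat.add_le_add_left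
    ((Finset.card_union_le _ _).trans <| Nat.add_le_add (hI _) <|
      (Finset.card_union_le _ _).trans <| Nat.add_le_add (hI _) <|
      (Finset.card_union_le _ _).trans <| Nat.add_le_add (hI _) <|
      (Finset.card_union_le _ _).trans <| Nat.add_le_add (hI _) <|
      (Finset.card_union_le _ _).trans <| Nat.add_le_add (hI _) (hI _))
    (properRectangles S).card
  linarith

/-- Many proper rectangles contain two with the same products that are in general position. -/
theorem exists_pair_properRectangles {S : Finset (Γ × Γ)}
    (h : 5 * Fintype.card Γ ^ 3 < (properRectangles S).card) :
    ∃ a a' b b' c c' d d' : Γ, (a, a', b, b') ∈ properRectangles S ∧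
      (c, c', d, d') ∈ properRectangles S ∧
      c * d = a * b ∧ c * d' = a * b' ∧ c' * d = a' * b ∧ c' * d' = a' * b' ∧
      c ≠ a ∧ c' ≠ a' ∧ c ≠ b ∧ c ≠ b' ∧ c' ≠ b ∧ c' ≠ b' := by
  let φ : Γ × Γ × Γ × Γ → Γ × Γ × Γ := fun q =>
    (q.1 * q.2.2.1, q.1 * q.2.2.2, q.2.1 * q.2.2.1)
  obtain ⟨w, -, hw⟩ := Finset.exists_lt_card_fiber_of_mul_lt_card_of_maps_to
    (s := properRectangles S) (t := Finset.univ) (f := φ) (n := 5) (fun _ _ => Finset.mem_univ _)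
    (by rw [Finset.card_univ]; simpa [pow_three, mul_comm] using h)
  set T := (properRectangles S).filter fun q => φ q = w with hT
  obtain ⟨⟨a, a', b, b'⟩, hq⟩ : T.Nonempty := Finset.card_pos.1 (by omega)
  have hφ : ∀ q ∈ T, φ q = φ (a, a', b, b') := fun q hq' =>
    (Finset.mem_filter.1 hq').2.trans (Finset.mem_filter.1 hq).2.symm
  -- An element of the fibre is determined by either of its first two entries.
  have hinj : ∀ q ∈ T, q = (q.1, a' * a⁻¹ * q.1, q.1⁻¹ * a * b, q.1⁻¹ * a * b') := by
    rintro ⟨c, c', d, d'⟩ hq'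
    have := hφ _ hq'
    simp only [φ, Prod.mk.injEq] at this
    obtain ⟨h1, h2, h3⟩ := this
    have hd : d = c⁻¹ * a * b := by rw [mul_assoc, ← h1]; group
    have hd' : d' = c⁻¹ * a * b' := by rw [mul_assoc, ← h2]; group
    have hc' : c' = a' * a⁻¹ * c := by
      have : c' = a' * b * d⁻¹ := by rw [← h3]; group
      rw [this, hd]; group
    simp only [hd, hd', hc']
  -- The values of `c` to avoid: `c = a` repeats the rectangle, and the last two amount to `c' = b`
  -- and `c' = b'`, as `c' = a' * a⁻¹ * c`. These five values account for the 5 in the hypothesis.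
  let B : Finset Γ := {a, b, b', a * a'⁻¹ * b, a * a'⁻¹ * b'}
  have hB : B.card ≤ 5 := Finset.card_le_five
  obtain ⟨x, hx, hxB⟩ : ∃ x ∈ T.image Prod.fst, x ∉ B := by
    apply Finset.exists_mem_notMem_of_card_lt_card
    rw [Finset.card_image_of_injOn]
    · omega
    · intro p hp q hq' hpq
      rw [hinj p hp, hinj q hq']
      rw [show p.1 = q.1 from hpq]
  obtain ⟨q, hqT, rfl⟩ := Finset.mem_image.1 hx
  have hq1 := hinj q hqT
  generalize q.1 = c at hq1 hxB
  subst hq1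
  simp only [B, Finset.mem_insert, Finset.mem_singleton, not_or] at hxB
  obtain ⟨n1, n2, n3, n4, n5⟩ := hxB
  refine ⟨a, a', b, b', c, _, _, _, (Finset.mem_filter.1 hq).1, (Finset.mem_filter.1 hqT).1,
    by group, by group, by group, by group, n1, ?_, n2, n3, ?_, ?_⟩
  · intro h; apply n1; rw [mul_assoc] at h; rwa [mul_eq_left, inv_mul_eq_one, eq_comm] at h
  · rintro rfl; apply n4; group
  · rintro rfl; apply n5; group

theorem hasCoreAtMost_of_card_properRectangles {S : Finset (Γ × Γ)}
    (h : 5 * Fintype.card Γ ^ 3 < (properRectangles S).card) :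
    (tripartiteTripleSystem S).HasCoreAtMost 12 ∧
      (elementTripleSystem S).HasCoreAtMost 12 := by
  obtain ⟨a, a', b, b', c, c', d, d', hq, hr, e1, e2, e3, e4, n1, n2, n3, n4, n5, n6⟩ :=
    exists_pair_properRectangles h
  simp only [properRectangles, rectangles, Finset.mem_filter, Finset.mem_univ, true_and] at hq hr
  let x : Bool × Bool → Γ := fun q => bif q.2 then (bif q.1 then c' else c) else
    (bif q.1 then a' else a)
  let y : Bool × Bool → Γ := fun q => bif q.2 then (bif q.1 then d' else d) else
    (bif q.1 then b' else b)
  -- The second rectangle (`true`) has the same products, so `false` is an arbitrary choice.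
  let z : Bool × Bool → Γ := fun q => x (q.1, false) * y (q.2, false)
  have hz : ∀ i j k, z (i, j) = x (i, k) * y (j, k) := by
    rintro (_ | _) (_ | _) (_ | _) <;> simp [z, x, y, *]
  have hP : ∀ i j k, (x (i, k), y (j, k)) ∈ properPairs S := by
    rintro (_ | _) (_ | _) (_ | _) <;> simp [x, y, hq, hr]
  have hP' : ∀ i j k, x (i, k) ≠ 1 ∧ y (j, k) ≠ 1 ∧ x (i, k) ≠ y (j, k) := fun i j k =>
    (Finset.mem_filter.1 (hP i j k)).2
  have hS : ∀ i j k, (x (i, k), y (j, k)) ∈ S := fun i j k =>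
    (Finset.mem_filter.1 (hP i j k)).1
  have hxx : ∀ k, x (false, k) ≠ x (true, k) := by
    rintro (_ | _) <;> simp [x, hq, hr]
  have hyy : ∀ k, y (false, k) ≠ y (true, k) := by
    rintro (_ | _) <;> simp [y, hq, hr]
  have hxk : ∀ i, x (i, true) ≠ x (i, false) := by
    rintro (_ | _) <;> simp [x, n1, n2]
  have hyz : ∀ i k, y (true, k) ≠ x (i, k) * y (false, k) := by
    rintro (_ | _) (_ | _) <;> simp only [x, y, cond_true, cond_false] <;> tauto
  have hxz : ∀ j k, x (true, k) ≠ x (false, k) * y (j, k) := by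
    rintro (_ | _) (_ | _) <;> simp only [x, y, cond_true, cond_false] <;> tauto
  have hxy : ∀ i j, x (i, true) ≠ y (j, false) := by
    rintro (_ | _) (_ | _) <;> simp only [x, y, cond_true, cond_false] <;> tauto
  constructor
  · refine ThreeGraph.hasCoreAtMost_of_cube _ (fun q => (0, x q)) (fun q => (1, y q))
      (fun q => (2, z q)) (fun i j k => ⟨_, hS i j k, ?_⟩) (fun i k he => ?_) (fun j k he => ?_)
      (fun i j he => ?_)
    · simp [tripartiteTriple, hz i j k]
    · have := he ▸ (by simp : ((1 : Fin 3), y (false, k)) ∈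
        ({(0, x (i, k)), (1, y (false, k)), (2, z (i, false))} : Finset (Fin 3 × Γ)))
      simp [hyy] at this
    · have := he ▸ (by simp : ((0 : Fin 3), x (false, k)) ∈
        ({(0, x (false, k)), (1, y (j, k)), (2, z (false, j))} : Finset (Fin 3 × Γ)))
      simp [hxx] at this
    · have := he ▸ (by simp : ((0 : Fin 3), x (i, false)) ∈
        ({(0, x (i, false)), (1, y (j, false)), (2, z (i, j))} : Finset (Fin 3 × Γ)))
      simp [(hxk i).symm] at this
  -- Vertices of different classes may now coincide, so each pair of edges is separated by a vertex
  -- of one that equals none of the three vertices of the other.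
  · refine ThreeGraph.hasCoreAtMost_of_cube _ x y z (fun i j k => ⟨?_, _, hS i j k, ?_⟩)
      (fun i k he => ?_) (fun j k he => ?_) (fun i j he => ?_)
    · rw [hz i j k]; exact card_triple_of_mem_properPairs (hP i j k)
    · simp only [hz i j k]
    · have := he.symm ▸ (by simp : y (true, k) ∈
        ({x (i, k), y (true, k), z (i, true)} : Finset Γ))
      rw [hz i false k] at this
      simp only [Finset.mem_insert, Finset.mem_singleton] at this
      rcases this with h | h | h
      exacts [(hP' i true k).2.2 h.symm, hyy k h.symm, hyz i k h]
    · have := he.symm ▸ (by simp : x (true, k) ∈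
        ({x (true, k), y (j, k), z (true, j)} : Finset Γ))
      rw [hz false j k] at this
      simp only [Finset.mem_insert, Finset.mem_singleton] at this
      rcases this with h | h | h
      exacts [hxx k h.symm, (hP' true j k).2.2 h, hxz j k h]
    · have := he.symm ▸ (by simp : x (i, true) ∈
        ({x (i, true), y (j, true), z (i, j)} : Finset Γ))
      simp only [Finset.mem_insert, Finset.mem_singleton] at this
      rcases this with h | h | h
      · exact hxk i h
      · exact hxy i j h
      · rw [hz i j true] at h
        exact (hP' i j true).2.1 (by simpa using h)

end Group

theorem mainTheorem8 (c : ℝ) (hc : 0 < c) :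
    ∃ m₀ : ℕ, ∀ (Γ : Type*) [Group Γ] [Fintype Γ] [DecidableEq Γ], m₀ ≤ Fintype.card Γ →
      ∀ S : Finset (Γ × Γ), c * (Fintype.card Γ : ℝ) ^ 2 ≤ (S.card : ℝ) →
        (tripartiteTripleSystem S).HasCoreAtMost 12 ∧
          (elementTripleSystem S).HasCoreAtMost 12 := by
  -- `6 / c` makes the `3m` improper pairs cost at most half the density; `11 = 6 + 5` covers the
  -- degenerate rectangles and the fibre size.
  obtain ⟨m₀, hm₀⟩ := exists_nat_gt (max (6 / c) (11 / (c / 2) ^ 4))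
  refine ⟨m₀, fun Γ _ _ _ hm S hS => hasCoreAtMost_of_card_properRectangles ?_⟩
  have h1 : (S.card : ℝ) ≤ (properPairs S).card + 3 * Fintype.card Γ := by
    exact_mod_cast card_le_card_properPairs S
  have h2 : ((properPairs S).card : ℝ) ^ 4 ≤
      (Fintype.card Γ : ℝ) ^ 4 * (rectangles (properPairs S)).card := by
    exact_mod_cast card_pow_four_le_card_rectangles (properPairs S)
  have h3 : ((rectangles (properPairs S)).card : ℝ) ≤
      (properRectangles S).card + 6 * (Fintype.card Γ : ℝ) ^ 3 := by
    exact_mod_cast card_rectangles_le S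
  have hmR : (m₀ : ℝ) ≤ Fintype.card Γ := by exact_mod_cast hm
  suffices 5 * (Fintype.card Γ : ℝ) ^ 3 < (properRectangles S).card by exact_mod_cast this
  set m : ℝ := (Fintype.card Γ : ℝ)
  obtain ⟨h4, h5⟩ := max_lt_iff.1 (hm₀.trans_le hmR)
  rw [div_lt_iff₀ hc] at h4
  rw [div_lt_iff₀ (by positivity)] at h5
  have hm0 : 0 < m := by
    by_contra! h
    nlinarith
  have h6 : c / 2 * m ^ 2 ≤ (properPairs S).card := by nlinarith
  have h7 : (c / 2 * m ^ 2) ^ 4 ≤ m ^ 4 * (rectangles (properPairs S)).card :=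
    (pow_le_pow_left₀ (by positivity) h6 4).trans h2
  have h8 : (c / 2) ^ 4 * m ^ 4 ≤ (rectangles (properPairs S)).card := by
    refine le_of_mul_le_mul_left (le_trans (le_of_eq ?_) h7) (pow_pos hm0 4)
    ring
  have h9 : 11 * m ^ 3 < (c / 2) ^ 4 * m ^ 4 := by
    have := mul_lt_mul_of_pos_right h5 (pow_pos hm0 3)
    linarith [show m * (c / 2) ^ 4 * m ^ 3 = (c / 2) ^ 4 * m ^ 4 by ring]
  linarith
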